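/- A distributive quasi relation algebra (DqRA) is an algebra $\mathbf A=\langle A,\wedge,\vee,\cdot,{\sim},-,\neg,1,0\rangle$ such that $\langle A,\wedge,\vee\rangle$ is a distributive lattice, $\langle A,\cdot,1\rangle$ is a monoid, $a\cdot b\le c\iff a\le -(b\cdot{\sim}c)\iff b\le{\sim}(-c\cdot a)$, $0=-1={\sim}1$, ${\sim}{-}a=a=-{\sim}a$, $\neg\neg a=a$, $\neg(a\vee b)=\neg a\wedge\neg b$, $\neg{\sim}a=-\neg a$ and $\neg(a\cdot b)=\neg a+\neg b$, where $a+b=-({\sim}b\cdot{\sim}a)$. Its residuals are $a\backslash c={\sim}(-c\cdot a)$ and $c/b=-(b\cdot{\sim}c)$. Let $(X,\le)$ be a poset, $E$ an equivalence relation on $X$ containing $\le$, $\alpha$ an order automorphism and $\beta$ a self-inverse dual order automorphism of $X$ whose graphs are contained in $E$ and satisfy $\beta=\alpha;\beta;\alpha$ (where $;$ is composition of relations). Order $E$ by $(u,v)\preccurlyeq(x,y)\iff x\le u$ and $v\le y$. Then $\mathbf{Dq}(\mathbf E)$ is the algebra of up-sets of $(E,\preccurlyeq)$ with operations $\cap$,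 $\cup$, $;$, ${\sim}R=R^{c\smile};\alpha$, $-R=\alpha;R^{c\smile}$, $\neg R=\alpha;\beta;R^c;\beta$, $1={\le}$ and $0=\alpha;{\le}^{c\smile}$, where $^c$ is complement in $E$ and $^\smile$ is converse. A DqRA is *representable* if it is isomorphic to a subalgebra of some $\mathbf{Dq}(\mathbf E)$, and *finitely representable* if moreover the poset $X$ can be taken finite. For odd $n=2k+1\ge 3$, the Sugihara chain $\mathbf S_n$ is the DqRA on $\{a_{-k},\dots,a_0,\dots,a_k\}$ with $a_i\wedge a_j=a_{\min\{i,j\}}$, $a_i\vee a_j=a_{\max\{i,j\}}$, ${\sim}a_i=-a_i=\neg a_i=a_{-i}$, $1=0=a_0$, and $a_i\cdot a_j$ equal to $a_i$ if $|j|<|i|$, to $a_j$ if $|i|<|j|$, and to $a_{\min\{i,j\}}$ if $|i|=|j|$. For DqRAs $\mathbf K$ and $\mathbf L$ on disjoint sets, such that $1_{\mathbf K}$ is totally irreducible (whenever a non-nullary operation of $\mathbf K$ takes the value $1_{\mathbf K}$, one of its arguments is $1_{\mathbf K}$; this holds in $\mathbf S_n$ for odd $n$), the nested sum $\mathbf K[\mathbf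 L]$ has universe $(K\setminus\{1_{\mathbf K}\})\cup L$ and constants $1=1_{\mathbf L}$, $0=0_{\mathbf L}$. Each of its operations extends those of $\mathbf L$ on $L$; the operations $\wedge,\vee,\cdot,\backslash,/,\neg$ extend those of $\mathbf K$ on $K\setminus\{1_{\mathbf K}\}$; for $k\in K\setminus\{1_{\mathbf K}\}$, $\ell\in L$ and $\star\in\{\cdot,\backslash,/\}$ we have $k\star\ell=k\star_{\mathbf K}1_{\mathbf K}$ and $\ell\star k=1_{\mathbf K}\star_{\mathbf K}k$; $k\wedge\ell=\ell\wedge k$ is $\ell$ if $k\ge 1_{\mathbf K}$ and $k\wedge_{\mathbf K}1_{\mathbf K}$ otherwise; $k\vee\ell=\ell\vee k$ is $\ell$ if $k\le1_{\mathbf K}$ and $k\vee_{\mathbf K}1_{\mathbf K}$ otherwise; and ${\sim}m=m\backslash 0$, $-m=0/m$ for all $m$. **Corollary.** Let $n\ge 3$ be odd. If $\mathbf L$ is a representable DqRA, then $\mathbf S_n[\mathbf L]$ is a representable DqRA; and if $\mathbf L$ is a finitely representable DqRA, then $\mathbf S_n[\mathbf L]$ is a finitely representable DqRA. -/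

import Mathlib

universe u v w

/-- The operations of the signature `⟨∧, ∨, ·, ∼, -, ¬, 1, 0⟩` of quasi relation algebras.
Meet, join, product, `1` and `0` are written `⊓`, `⊔`, `*`, `1` and `0`. -/
class QRAOps (A : Type u) extends Min A, Max A, Mul A, One A, Zero A where
  /-- the linear negation `∼a` -/
  tilde : A → A
  /-- the linear negation `-a` -/
  minus : A → A
  /-- the involution `¬a` -/
  dneg : A → A

namespace QRAOps

variable {A : Type u} [QRAOps A]

/-- The lattice order of the algebra. -/
def Below (a b : A) : Prop := a ⊓ b = a

/-- The left residual `a \ c = ∼(-c · a)`. -/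
def ldiv (a c : A) : A := tilde (minus c * a)

/-- The right residual `c / b = -(b · ∼c)`. -/
def rdiv (c b : A) : A := minus (b * tilde c)

/-- The dual `a + b = -(∼b · ∼a)` of the product. -/
def dsum (a b : A) : A := minus (tilde b * tilde a)

end QRAOps

open QRAOps

/-- Distributive quasi relation algebras. -/
structure IsDqRA (A : Type u) [QRAOps A] : Prop where
  inf_comm : ∀ a b : A, a ⊓ b = b ⊓ a
  sup_comm : ∀ a b : A, a ⊔ b = b ⊔ a
  inf_assoc : ∀ a b c : A, (a ⊓ b) ⊓ c = a ⊓ (b ⊓ c)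
  sup_assoc : ∀ a b c : A, (a ⊔ b) ⊔ c = a ⊔ (b ⊔ c)
  inf_sup_self : ∀ a b : A, a ⊓ (a ⊔ b) = a
  sup_inf_self : ∀ a b : A, a ⊔ (a ⊓ b) = a
  inf_sup_left : ∀ a b c : A, a ⊓ (b ⊔ c) = (a ⊓ b) ⊔ (a ⊓ c)
  mul_assoc : ∀ a b c : A, (a * b) * c = a * (b * c)
  one_mul : ∀ a : A, 1 * a = a
  mul_one : ∀ a : A, a * 1 = a
  /-- the product is residuated, with the residuals given by the linear negations -/
  mul_below_iff_rdiv : ∀ a b c : A, Below (a * b) c ↔ Below a (rdiv c b)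
  mul_below_iff_ldiv : ∀ a b c : A, Below (a * b) c ↔ Below b (ldiv a c)
  minus_one : minus (1 : A) = 0
  tilde_one : tilde (1 : A) = 0
  tilde_minus : ∀ a : A, tilde (minus a) = a
  minus_tilde : ∀ a : A, minus (tilde a) = a
  dneg_dneg : ∀ a : A, dneg (dneg a) = a
  /-- (Dm) -/
  dneg_sup : ∀ a b : A, dneg (a ⊔ b) = dneg a ⊓ dneg b
  /-- (Di) -/
  dneg_tilde : ∀ a : A, dneg (tilde a) = minus (dneg a)
  /-- (Dp) -/
  dneg_mul : ∀ a b : A, dneg (a * b) = dsum (dneg a) (dneg b)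

/-! ### Odd Sugihara chains -/

/-- The universe `{a_{-k}, …, a_0, …, a_k}` of the Sugihara chain `S_n` for **odd** `n = 2k + 1`
(so that `k = n / 2`); the element `a_i` is given by its index `i`. (For even `n` this is not the
Sugihara chain `S_n`.) -/
@[ext]
structure OddSugiharaChain (n : ℕ) : Type where
  /-- the index `i` of the element `a_i` -/
  idx : ℤ
  abs_idx_le : |idx| ≤ ((n / 2 : ℕ) : ℤ)

namespace OddSugiharaChain

variable {n : ℕ}

/-- The index of `a_i · a_j`. -/
def mulIdx (i j : ℤ) : ℤ := if |j| < |i| then i else if |i| < |j| then j else min i j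

lemma abs_mulIdx_le {i j k : ℤ} (hi : |i| ≤ k) (hj : |j| ≤ k) : |mulIdx i j| ≤ k := by
  unfold mulIdx
  split_ifs
  · exact hi
  · exact hj
  · rcases min_choice i j with h | h <;> rw [h] <;> assumption

/-- The chain as an algebra in the signature of quasi relation algebras: all three negations send
`a_i` to `a_{-i}`, and `1 = 0 = a_0`. -/
instance : QRAOps (OddSugiharaChain n) where
  min a b := ⟨min a.idx b.idx, by
    rcases min_choice a.idx b.idx with h | h <;> rw [h]
    exacts [a.abs_idx_le, b.abs_idx_le]⟩
  max a b := ⟨max a.idx b.idx, by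
    rcases max_choice a.idx b.idx with h | h <;> rw [h]
    exacts [a.abs_idx_le, b.abs_idx_le]⟩
  mul a b := ⟨mulIdx a.idx b.idx, abs_mulIdx_le a.abs_idx_le b.abs_idx_le⟩
  one := ⟨0, by rw [abs_zero]; exact Int.natCast_nonneg _⟩
  zero := ⟨0, by rw [abs_zero]; exact Int.natCast_nonneg _⟩
  tilde a := ⟨-a.idx, by rw [abs_neg]; exact a.abs_idx_le⟩
  minus a := ⟨-a.idx, by rw [abs_neg]; exact a.abs_idx_le⟩
  dneg a := ⟨-a.idx, by rw [abs_neg]; exact a.abs_idx_le⟩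

end OddSugiharaChain

/-! ### Nested sums -/

/-- The identity `1` is irreducible with respect to all non-nullary operations. -/
structure OneTotallyIrreducible (K : Type u) [QRAOps K] : Prop where
  inf : ∀ a b : K, a ⊓ b = 1 → a = 1 ∨ b = 1
  sup : ∀ a b : K, a ⊔ b = 1 → a = 1 ∨ b = 1
  mul : ∀ a b : K, a * b = 1 → a = 1 ∨ b = 1
  tilde : ∀ a : K, tilde a = 1 → a = 1
  minus : ∀ a : K, minus a = 1 → a = 1
  dneg : ∀ a : K, dneg a = 1 → a = 1

/-- The universe `K[L] = (K \ {1}) ∪ L` (a disjoint union) of the nested sum. -/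
inductive NestedSum (K : Type u) (L : Type v) [QRAOps K] : Type (max u v) where
  /-- the elements of `K \ {1}` -/
  | outer (k : K) (hk : k ≠ 1) : NestedSum K L
  /-- the elements of `L` -/
  | inner (l : L) : NestedSum K L

namespace NestedSum

variable {K : Type u} {L : Type v} [QRAOps K] [QRAOps L]

open Classical in
/-- An element `k` of `K`, as an element of `K[L]`. Below this is applied only to values of
operations of `K` which, for a quasi relation algebra `K` with `1` totally irreducible (the case in
which nested sums are formed), are never `1`; the value at `1` is therefore immaterial. -/
noncomputable def ofK (k : K) : NestedSum K L :=
  if hk : k = 1 then inner 1 else outer k hk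

/-- The extension to `K[L]` of binary operations `fK` on `K` and `fL` on `L`, where in mixed cases
an element of `L` is treated as the identity of `K`. -/
noncomputable def op (fK : K → K → K) (fL : L → L → L) :
    NestedSum K L → NestedSum K L → NestedSum K L
  | outer k _, outer k' _ => ofK (fK k k')
  | inner l, inner l' => inner (fL l l')
  | outer k _, inner _ => ofK (fK k 1)
  | inner _, outer k _ => ofK (fK 1 k)

open Classical in
/-- Meet in `K[L]`. -/
noncomputable def meet : NestedSum K L → NestedSum K L → NestedSum K L
  | outer k _, outer k' _ => ofK (k ⊓ k')
  | inner l, inner l' => inner (l ⊓ l')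
  | outer k _, inner l => if Below 1 k then inner l else ofK (k ⊓ 1)
  | inner l, outer k _ => if Below 1 k then inner l else ofK (k ⊓ 1)

open Classical in
/-- Join in `K[L]`. -/
noncomputable def join : NestedSum K L → NestedSum K L → NestedSum K L
  | outer k _, outer k' _ => ofK (k ⊔ k')
  | inner l, inner l' => inner (l ⊔ l')
  | outer k _, inner l => if Below k 1 then inner l else ofK (k ⊔ 1)
  | inner l, outer k _ => if Below k 1 then inner l else ofK (k ⊔ 1)

/-- The involution `¬` of `K[L]`. -/
noncomputable def involution : NestedSum K L → NestedSum K L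
  | outer k _ => ofK (dneg k)
  | inner l => inner (dneg l)

/-- The nested sum `K[L]`, with `∼m = m \ 0` and `-m = 0 / m` for the residuals of `K[L]`. -/
noncomputable instance : QRAOps (NestedSum K L) where
  min := meet
  max := join
  mul := op (fun a b => a * b) (fun a b => a * b)
  one := inner 1
  zero := inner 0
  tilde m := op ldiv ldiv m (inner 0)
  minus m := op rdiv rdiv (inner 0) m
  dneg := involution

end NestedSum

/-- In an odd Sugihara chain the identity is totally irreducible, so that the nested sum of an odd
Sugihara chain and `L` may be formed. -/
lemma OddSugiharaChain.oneTotallyIrreducible (n : ℕ) :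
    OneTotallyIrreducible (OddSugiharaChain n) := by
  have key : ∀ a : OddSugiharaChain n, a = 1 ↔ a.idx = 0 := fun a => OddSugiharaChain.ext_iff
  refine ⟨fun a b h => ?_, fun a b h => ?_, fun a b h => ?_, fun a h => ?_, fun a h => ?_,
    fun a h => ?_⟩
  · simp only [key] at h ⊢
    change min a.idx b.idx = 0 at h
    omega
  · simp only [key] at h ⊢
    change max a.idx b.idx = 0 at h
    omega
  · simp only [key] at h ⊢
    change OddSugiharaChain.mulIdx a.idx b.idx = 0 at h
    unfold OddSugiharaChain.mulIdx at h
    split_ifs at h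
    · exact Or.inl h
    · exact Or.inr h
    · omega
  · simp only [key] at h ⊢
    exact neg_eq_zero.mp h
  · simp only [key] at h ⊢
    exact neg_eq_zero.mp h
  · simp only [key] at h ⊢
    exact neg_eq_zero.mp h

/-! ### Algebras of binary relations and representability -/

open scoped SetRel

/-- The data on a poset `X` from which an algebra of binary relations is built: an equivalence
relation `E` containing the order, an order automorphism `α` and a self-inverse dual order
automorphism `β`, with `α, β ⊆ E` and `β = α ; β ; α`. -/
structure RelFrame (X : Type w) [PartialOrder X] where
  /-- the equivalence relation -/
  E : Setoid X
  le_sub : ∀ x y : X, x ≤ y → E x y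
  /-- the order automorphism -/
  α : X ≃o X
  /-- the dual order automorphism -/
  β : X → X
  β_β : ∀ x, β (β x) = x
  β_anti : ∀ x y, x ≤ y → β y ≤ β x
  α_sub : ∀ x, E x (α x)
  β_sub : ∀ x, E x (β x)
  graph_β : Function.graph β = Function.graph α ○ Function.graph β ○ Function.graph α

namespace RelFrame

variable {X : Type w} [PartialOrder X] (F : RelFrame X)

/-- The order `(a, b) ≼ (x, y) ↔ x ≤ a ∧ b ≤ y` on pairs. -/
def PairLE (p q : X × X) : Prop := q.1 ≤ p.1 ∧ p.2 ≤ q.2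

/-- `Up(E, ≼)`: the up-sets of the equivalence relation `E`, ordered by `≼`. -/
@[ext]
structure Dq where
  /-- the underlying binary relation -/
  rel : SetRel X X
  sub : ∀ p ∈ rel, F.E p.1 p.2
  up : ∀ p ∈ rel, ∀ q : X × X, F.E q.1 q.2 → PairLE p q → q ∈ rel

/-- The complement of a binary relation in `E`. -/
def compl (R : SetRel X X) : SetRel X X := {p | F.E p.1 p.2 ∧ p ∉ R}

/-- The order of `X`, as a binary relation. -/
def leRel : SetRel X X := {p | p.1 ≤ p.2}

variable {F}

lemma graph_α_comp (R : SetRel X X) :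
    Function.graph F.α ○ R = {p | (F.α p.1, p.2) ∈ R} := by
  ext ⟨x, y⟩
  simp [SetRel.comp, Function.graph]

lemma comp_graph_α (R : SetRel X X) :
    R ○ Function.graph F.α = {p | (p.1, F.α.symm p.2) ∈ R} := by
  ext ⟨x, y⟩
  constructor
  · rintro ⟨z, hz, rfl⟩
    simpa using hz
  · intro h
    exact ⟨F.α.symm y, h, F.α.apply_symm_apply y⟩

lemma graph_β_comp (R : SetRel X X) :
    Function.graph F.β ○ R = {p | (F.β p.1, p.2) ∈ R} := by
  ext ⟨x, y⟩
  simp [SetRel.comp, Function.graph]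

lemma comp_graph_β (R : SetRel X X) :
    R ○ Function.graph F.β = {p | (p.1, F.β p.2) ∈ R} := by
  ext ⟨x, y⟩
  constructor
  · rintro ⟨z, hz, rfl⟩
    simpa [F.β_β] using hz
  · intro h
    exact ⟨F.β y, h, F.β_β y⟩

lemma α_symm_sub (x : X) : F.E x (F.α.symm x) := by
  have h := F.α_sub (F.α.symm x)
  rw [F.α.apply_symm_apply] at h
  exact F.E.symm h

/-- If `R` is an up-set, so is `R^{c⌣} ; α`. -/
def Dq.tilde (R : Dq F) : Dq F where
  rel := (F.compl R.rel).inv ○ Function.graph F.α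
  sub := by
    rw [comp_graph_α]
    rintro ⟨x, y⟩ ⟨h, -⟩
    exact F.E.trans (F.E.symm h) (F.E.symm (α_symm_sub y))
  up := by
    rw [comp_graph_α]
    rintro ⟨x, y⟩ ⟨h, hn⟩ ⟨x', y'⟩ hE ⟨hx, hy⟩
    refine ⟨F.E.symm (F.E.trans hE (α_symm_sub y')), fun hR => hn ?_⟩
    exact R.up _ hR _ h ⟨F.α.symm.monotone hy, hx⟩

/-- If `R` is an up-set, so is `α ; R^{c⌣}`. -/
def Dq.minus (R : Dq F) : Dq F where
  rel := Function.graph F.α ○ (F.compl R.rel).inv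
  sub := by
    rw [graph_α_comp]
    rintro ⟨x, y⟩ ⟨h, -⟩
    exact F.E.trans (F.α_sub x) (F.E.symm h)
  up := by
    rw [graph_α_comp]
    rintro ⟨x, y⟩ ⟨h, hn⟩ ⟨x', y'⟩ hE ⟨hx, hy⟩
    refine ⟨F.E.symm (F.E.trans (F.E.symm (F.α_sub x')) hE), fun hR => hn ?_⟩
    exact R.up _ hR _ h ⟨hy, F.α.monotone hx⟩

/-- If `R` is an up-set, so is `α ; β ; R^c ; β`. -/
def Dq.dneg (R : Dq F) : Dq F where
  rel := Function.graph F.α ○ (Function.graph F.β ○ F.compl R.rel ○ Function.graph F.β)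
  sub := by
    rw [graph_α_comp, comp_graph_β, graph_β_comp]
    rintro ⟨x, y⟩ ⟨h, -⟩
    exact F.E.trans (F.E.trans (F.α_sub x) (F.β_sub _)) (F.E.trans h (F.E.symm (F.β_sub y)))
  up := by
    rw [graph_α_comp, comp_graph_β, graph_β_comp]
    rintro ⟨x, y⟩ ⟨h, hn⟩ ⟨x', y'⟩ hE ⟨hx, hy⟩
    refine ⟨F.E.trans (F.E.symm (F.E.trans (F.α_sub x') (F.β_sub _)))
      (F.E.trans hE (F.β_sub y')), fun hR => hn ?_⟩
    exact R.up _ hR _ h ⟨F.β_anti _ _ (F.α.monotone hx), F.β_anti _ _ hy⟩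

/-- The order of `X` is an up-set. -/
def Dq.one : Dq F where
  rel := leRel
  sub _ hp := F.le_sub _ _ hp
  up _ hp _ _ h := h.1.trans (le_trans hp h.2)

/-- The composition of two up-sets is an up-set. -/
def Dq.comp (R S : Dq F) : Dq F where
  rel := R.rel ○ S.rel
  sub := by
    rintro ⟨x, y⟩ ⟨z, hR, hS⟩
    exact F.E.trans (R.sub (x, z) hR) (S.sub (z, y) hS)
  up := by
    rintro ⟨x, y⟩ ⟨z, hR, hS⟩ ⟨x', y'⟩ - ⟨hx, hy⟩
    exact ⟨z, R.up _ hR (x', z) (F.E.trans (F.le_sub _ _ hx) (R.sub (x, z) hR)) ⟨hx, le_rfl⟩,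
      S.up _ hS (z, y') (F.E.trans (S.sub (z, y) hS) (F.le_sub _ _ hy)) ⟨le_rfl, hy⟩⟩

/-- The algebra `Dq(E)` of binary relations: meet and join are intersection and union, the product
is relational composition, `1` is the order, `0 = α ; ≤^{c⌣}`, and the negations are
`∼R = R^{c⌣} ; α`, `-R = α ; R^{c⌣}` and `¬R = α ; β ; R^c ; β`. -/
instance : QRAOps (Dq F) where
  min R S := ⟨R.rel ∩ S.rel, fun p hp => R.sub p hp.1,
    fun p hp q hq h => ⟨R.up p hp.1 q hq h, S.up p hp.2 q hq h⟩⟩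
  max R S := ⟨R.rel ∪ S.rel, fun p hp => hp.elim (R.sub p) (S.sub p),
    fun p hp q hq h => hp.imp (fun hp => R.up p hp q hq h) (fun hp => S.up p hp q hq h)⟩
  mul := Dq.comp
  one := Dq.one
  zero := Dq.minus Dq.one
  tilde := Dq.tilde
  minus := Dq.minus
  dneg := Dq.dneg

end RelFrame

/-- Embeddings: injective maps preserving all the operations. -/
structure IsQRAEmbedding {A : Type u} {B : Type v} [QRAOps A] [QRAOps B] (φ : A → B) : Prop where
  injective : Function.Injective φ
  map_inf : ∀ a b, φ (a ⊓ b) = φ a ⊓ φ b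
  map_sup : ∀ a b, φ (a ⊔ b) = φ a ⊔ φ b
  map_mul : ∀ a b, φ (a * b) = φ a * φ b
  map_tilde : ∀ a, φ (tilde a) = tilde (φ a)
  map_minus : ∀ a, φ (minus a) = minus (φ a)
  map_dneg : ∀ a, φ (dneg a) = dneg (φ a)
  map_one : φ 1 = 1
  map_zero : φ 0 = 0

/-- A DqRA is representable if it is isomorphic to a subalgebra of some `Dq(E)`; the underlying
posets range over the universe `w`. -/
def IsRepresentable (A : Type u) [QRAOps A] : Prop :=
  IsDqRA A ∧ ∃ (X : Type w) (_ : PartialOrder X) (F : RelFrame X) (φ : A → F.Dq),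
    IsQRAEmbedding φ

/-- A DqRA is finitely representable if it is representable over a finite poset. -/
def IsFinitelyRepresentable (A : Type u) [QRAOps A] : Prop :=
  IsDqRA A ∧ ∃ (X : Type w) (_ : PartialOrder X) (_ : Finite X) (F : RelFrame X) (φ : A → F.Dq),
    IsQRAEmbedding φ

/-! ### `Dq(E)` pointwise, and its DqRA laws -/

namespace RelFrame

variable {X : Type w} [PartialOrder X] {F : RelFrame X}

/-! The chain `S_{2k+1}` is built from `S_1` by adding a new bottom and a new top `k` times, so
`S_{2k+1}[L]` arises from `L` in the same way (`isQRAEmbedding_toInner`,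
`isQRAEmbedding_toBounded`). It therefore suffices to represent `Bounded A` whenever `A` is
represented (`isQRAEmbedding_extend`).

Given `A` in `Dq(E)` over `X`, put two incomparable points below and two above each block of `E`.
Let `α` swap the two points of a level and `β` swap the levels. Send `bot` to the empty relation,
`top` to the whole equivalence relation, and `mid a` to the relation of `a` enlarged by all pairs
going up a level within a block and by the diagonal of the new points. Two points per level are
needed for the negations: the complement of the diagonal on a level is the swap, which the `α` in
each negation turns back into the diagonal. One extra block without points of `X` keeps the three
kinds of elements apart even when `X` is empty.

The DqRA laws of `S_n[L]` need no direct check: they hold in every `Dq(E)` and pass to subalgebras.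
-/

lemma α_β_α (x : X) : F.α (F.β (F.α x)) = F.β x := by
  have h : (x, F.β x) ∈ Function.graph F.β := rfl
  rw [F.graph_β, graph_α_comp, comp_graph_α] at h
  rw [show F.β (F.α x) = F.α.symm (F.β x) from h, F.α.apply_symm_apply]

/-- The form of `β = α ; β ; α` behind the law `¬∼a = -¬a`. -/
lemma α_symm_β (x : X) : F.α.symm (F.β x) = F.β (F.α x) := by
  rw [← α_β_α, F.α.symm_apply_apply]

lemma E_α_right {x y : X} : F.E x (F.α y) ↔ F.E x y :=
  ⟨fun h => F.E.trans h (F.E.symm (F.α_sub y)), fun h => F.E.trans h (F.α_sub y)⟩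

lemma E_β_right {x y : X} : F.E x (F.β y) ↔ F.E x y :=
  ⟨fun h => F.E.trans h (F.E.symm (F.β_sub y)), fun h => F.E.trans h (F.β_sub y)⟩

lemma E_comm {x y : X} : F.E x y ↔ F.E y x := ⟨F.E.symm, F.E.symm⟩

lemma E_α_left {x y : X} : F.E (F.α x) y ↔ F.E x y := by
  rw [E_comm, E_α_right, E_comm]

lemma E_β_left {x y : X} : F.E (F.β x) y ↔ F.E x y := by
  rw [E_comm, E_β_right, E_comm]

lemma E_α_symm_left {x y : X} : F.E (F.α.symm x) y ↔ F.E x y := by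
  rw [← E_α_left, F.α.apply_symm_apply]

namespace Dq

/-- Membership of a pair in an element of `Dq(E)`. -/
def Holds (R : Dq F) (x y : X) : Prop := (x, y) ∈ R.rel

lemma ext_holds {R S : Dq F} (h : ∀ x y, R.Holds x y ↔ S.Holds x y) : R = S :=
  Dq.ext (Set.ext fun p => h p.1 p.2)

lemma Holds.E {R : Dq F} {x y : X} (h : R.Holds x y) : F.E x y := R.sub _ h

lemma Holds.mono {R : Dq F} {x y x' y' : X} (h : R.Holds x y) (hx : x' ≤ x) (hy : y ≤ y') :
    R.Holds x' y' :=
  R.up _ h (x', y') (F.E.trans (F.le_sub _ _ hx) (F.E.trans h.E (F.le_sub _ _ hy))) ⟨hx, hy⟩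

lemma holds_inf (R S : Dq F) (x y : X) : (R ⊓ S).Holds x y ↔ R.Holds x y ∧ S.Holds x y := Iff.rfl

lemma holds_sup (R S : Dq F) (x y : X) : (R ⊔ S).Holds x y ↔ R.Holds x y ∨ S.Holds x y := Iff.rfl

lemma holds_mul (R S : Dq F) (x y : X) :
    (R * S).Holds x y ↔ ∃ z, R.Holds x z ∧ S.Holds z y := Iff.rfl

lemma holds_one (x y : X) : (1 : Dq F).Holds x y ↔ x ≤ y := Iff.rfl

/-- Since `α` stays within blocks, the condition of lying in `E` loses its twist, and only the
negated membership keeps it. -/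
lemma holds_tilde (R : Dq F) (x y : X) :
    (QRAOps.tilde R).Holds x y ↔ F.E x y ∧ ¬ R.Holds (F.α.symm y) x := by
  change (x, y) ∈ (F.compl R.rel).inv ○ Function.graph F.α ↔ _
  rw [comp_graph_α]
  change F.E (F.α.symm y) x ∧ _ ↔ _
  rw [E_α_symm_left, E_comm]
  rfl

lemma holds_minus (R : Dq F) (x y : X) :
    (QRAOps.minus R).Holds x y ↔ F.E x y ∧ ¬ R.Holds y (F.α x) := by
  change (x, y) ∈ Function.graph F.α ○ (F.compl R.rel).inv ↔ _
  rw [graph_α_comp]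
  change F.E y (F.α x) ∧ _ ↔ _
  rw [E_α_right, E_comm]
  rfl

lemma holds_dneg (R : Dq F) (x y : X) :
    (QRAOps.dneg R).Holds x y ↔ F.E x y ∧ ¬ R.Holds (F.β (F.α x)) (F.β y) := by
  change (x, y) ∈ Function.graph F.α ○ (Function.graph F.β ○ F.compl R.rel ○ Function.graph F.β)
    ↔ _
  rw [graph_α_comp, comp_graph_β, graph_β_comp]
  change F.E (F.β (F.α x)) (F.β y) ∧ _ ↔ _
  rw [E_β_right, E_β_left, E_α_left]
  rfl

lemma holds_zero (x y : X) : (0 : Dq F).Holds x y ↔ F.E x y ∧ ¬ y ≤ F.α x := holds_minus 1 x y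

lemma below_iff (R S : Dq F) : Below R S ↔ ∀ x y, R.Holds x y → S.Holds x y := by
  constructor
  · intro h x y hR
    rw [← show R ⊓ S = R from h] at hR
    exact hR.2
  · exact fun h => ext_holds fun x y => ⟨And.left, fun hR => ⟨hR, h x y hR⟩⟩

/-- The algebra `Dq(E)` is a DqRA. -/
theorem isDqRA (F : RelFrame X) : IsDqRA F.Dq where
  inf_comm _ _ := ext_holds fun _ _ => and_comm
  sup_comm _ _ := ext_holds fun _ _ => or_comm
  inf_assoc _ _ _ := ext_holds fun _ _ => and_assoc
  sup_assoc _ _ _ := ext_holds fun _ _ => or_assoc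
  inf_sup_self _ _ := ext_holds fun _ _ => ⟨And.left, fun h => ⟨h, Or.inl h⟩⟩
  sup_inf_self _ _ := ext_holds fun _ _ => ⟨fun h => h.elim id And.left, Or.inl⟩
  inf_sup_left _ _ _ := ext_holds fun _ _ => and_or_left
  mul_assoc R S T := ext_holds fun x y => by
    simp only [holds_mul]
    constructor
    · rintro ⟨z, ⟨t, h₁, h₂⟩, h₃⟩
      exact ⟨t, h₁, z, h₂, h₃⟩
    · rintro ⟨t, h₁, z, h₂, h₃⟩
      exact ⟨z, ⟨t, h₁, h₂⟩, h₃⟩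
  one_mul R := ext_holds fun x y => by
    simp only [holds_mul, holds_one]
    exact ⟨fun ⟨z, h, hR⟩ => hR.mono h le_rfl, fun h => ⟨x, le_rfl, h⟩⟩
  mul_one R := ext_holds fun x y => by
    simp only [holds_mul, holds_one]
    exact ⟨fun ⟨z, hR, h⟩ => hR.mono le_rfl h, fun h => ⟨y, h, le_rfl⟩⟩
  mul_below_iff_rdiv R S T := by
    -- The twists of `-` and `∼` cancel: inside `E`, the residual relates `x` to `y` iff `T` relates
    -- `x` to every `S`-successor of `y`.
    simp only [below_iff, rdiv, holds_minus, holds_mul, holds_tilde, F.α.symm_apply_apply]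
    constructor
    · rintro h x y hR
      refine ⟨hR.E, ?_⟩
      rintro ⟨z, hS, -, hT⟩
      exact hT (h _ _ ⟨y, hR, hS⟩)
    · rintro h x y ⟨z, hR, hS⟩
      by_contra hT
      exact (h x z hR).2 ⟨y, hS, E_α_right.2 (F.E.symm (F.E.trans hR.E hS.E)), hT⟩
  mul_below_iff_ldiv R S T := by
    simp only [below_iff, ldiv, holds_minus, holds_mul, holds_tilde, F.α.apply_symm_apply]
    constructor
    · rintro h x y hS
      refine ⟨hS.E, ?_⟩
      rintro ⟨z, ⟨-, hT⟩, hR⟩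
      exact hT (h _ _ ⟨x, hR, hS⟩)
    · rintro h x y ⟨z, hR, hS⟩
      by_contra hT
      exact (h z y hS).2 ⟨x, ⟨E_α_symm_left.2 (F.E.symm (F.E.trans hR.E hS.E)), hT⟩, hR⟩
  minus_one := rfl
  tilde_one := ext_holds fun x y => by
    rw [holds_tilde, holds_zero, holds_one, F.α.symm_apply_le]
  tilde_minus R := ext_holds fun x y => by
    rw [holds_tilde, holds_minus, F.α.apply_symm_apply, E_α_symm_left]
    exact ⟨fun h => by_contra fun hR => h.2 ⟨F.E.symm h.1, hR⟩, fun h => ⟨h.E, fun h' => h'.2 h⟩⟩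
  minus_tilde R := ext_holds fun x y => by
    rw [holds_minus, holds_tilde, F.α.symm_apply_apply, E_α_right]
    exact ⟨fun h => by_contra fun hR => h.2 ⟨F.E.symm h.1, hR⟩, fun h => ⟨h.E, fun h' => h'.2 h⟩⟩
  dneg_dneg R := ext_holds fun x y => by
    -- The twice twisted first coordinate `β (α (β (α x)))` collapses to `x`.
    rw [holds_dneg, holds_dneg, α_β_α, F.β_β, F.β_β, E_β_right, E_β_left, E_α_left]
    exact ⟨fun h => by_contra fun hR => h.2 ⟨h.1, hR⟩, fun h => ⟨h.E, fun h' => h'.2 h⟩⟩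
  dneg_sup R S := ext_holds fun x y => by
    simp only [holds_dneg, holds_sup, holds_inf]
    tauto
  dneg_tilde R := ext_holds fun x y => by
    simp only [holds_dneg, holds_tilde, holds_minus, E_β_right, E_β_left, E_α_left, E_α_right,
      α_symm_β, E_comm (x := y) (y := x)]
  dneg_mul R S := ext_holds fun x y => by
    simp only [holds_dneg, dsum, holds_minus, holds_mul, holds_tilde, F.α.symm_apply_apply,
      E_α_right, E_α_symm_left, F.α.apply_symm_apply, not_and, not_not]
    -- Both sides assert an intermediate point for `R` and `S`; the two points correspond under the
    -- involution `β`.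
    refine and_congr_right fun hE => not_congr ⟨?_, ?_⟩
    · rintro ⟨z, hR, hS⟩
      have h₁ : F.E x z := E_α_left.1 (E_β_left.1 hR.E)
      have h₂ : F.E z y := E_β_right.1 hS.E
      exact ⟨F.β z, ⟨E_β_right.2 (F.E.symm h₂), fun _ => by rwa [F.β_β]⟩,
        E_β_left.2 (F.E.symm h₁), fun _ => by rwa [F.β_β]⟩
    · rintro ⟨z, ⟨h₁, hS⟩, h₂, hR⟩
      exact ⟨F.β z, hR (F.E.symm h₂), hS (F.E.symm h₁)⟩

end Dq

end RelFrame

/-! ### Embeddings and subalgebras -/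

namespace IsQRAEmbedding

variable {A : Type*} {B : Type*} {C : Type*} [QRAOps A] [QRAOps B] [QRAOps C]

lemma comp {g : B → C} {f : A → B} (hg : IsQRAEmbedding g) (hf : IsQRAEmbedding f) :
    IsQRAEmbedding (g ∘ f) where
  injective := hg.injective.comp hf.injective
  map_inf a b := by simp only [Function.comp, hf.map_inf, hg.map_inf]
  map_sup a b := by simp only [Function.comp, hf.map_sup, hg.map_sup]
  map_mul a b := by simp only [Function.comp, hf.map_mul, hg.map_mul]
  map_tilde a := by simp only [Function.comp, hf.map_tilde, hg.map_tilde]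
  map_minus a := by simp only [Function.comp, hf.map_minus, hg.map_minus]
  map_dneg a := by simp only [Function.comp, hf.map_dneg, hg.map_dneg]
  map_one := by simp only [Function.comp, hf.map_one, hg.map_one]
  map_zero := by simp only [Function.comp, hf.map_zero, hg.map_zero]

lemma below_iff {f : A → B} (hf : IsQRAEmbedding f) (a b : A) : Below (f a) (f b) ↔ Below a b := by
  rw [Below, Below, ← hf.map_inf, hf.injective.eq_iff]

/-- A subalgebra of a DqRA is a DqRA. -/
theorem isDqRA {f : A → B} (hf : IsQRAEmbedding f) (hB : IsDqRA B) : IsDqRA A where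
  inf_comm a b := hf.injective (by simp only [hf.map_inf, hB.inf_comm (f a)])
  sup_comm a b := hf.injective (by simp only [hf.map_sup, hB.sup_comm (f a)])
  inf_assoc a b c := hf.injective (by simp only [hf.map_inf, hB.inf_assoc])
  sup_assoc a b c := hf.injective (by simp only [hf.map_sup, hB.sup_assoc])
  inf_sup_self a b := hf.injective (by simp only [hf.map_inf, hf.map_sup, hB.inf_sup_self])
  sup_inf_self a b := hf.injective (by simp only [hf.map_inf, hf.map_sup, hB.sup_inf_self])
  inf_sup_left a b c := hf.injective (by simp only [hf.map_inf, hf.map_sup, hB.inf_sup_left])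
  mul_assoc a b c := hf.injective (by simp only [hf.map_mul, hB.mul_assoc])
  one_mul a := hf.injective (by simp only [hf.map_mul, hf.map_one, hB.one_mul])
  mul_one a := hf.injective (by simp only [hf.map_mul, hf.map_one, hB.mul_one])
  mul_below_iff_rdiv a b c := by
    rw [← hf.below_iff, ← hf.below_iff, hf.map_mul, hB.mul_below_iff_rdiv, rdiv, rdiv,
      hf.map_minus, hf.map_mul, hf.map_tilde]
  mul_below_iff_ldiv a b c := by
    rw [← hf.below_iff, ← hf.below_iff, hf.map_mul, hB.mul_below_iff_ldiv, ldiv, ldiv,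
      hf.map_tilde, hf.map_mul, hf.map_minus]
  minus_one := hf.injective (by rw [hf.map_minus, hf.map_one, hf.map_zero, hB.minus_one])
  tilde_one := hf.injective (by rw [hf.map_tilde, hf.map_one, hf.map_zero, hB.tilde_one])
  tilde_minus a := hf.injective (by rw [hf.map_tilde, hf.map_minus, hB.tilde_minus])
  minus_tilde a := hf.injective (by rw [hf.map_minus, hf.map_tilde, hB.minus_tilde])
  dneg_dneg a := hf.injective (by rw [hf.map_dneg, hf.map_dneg, hB.dneg_dneg])
  dneg_sup a b := hf.injective (by
    simp only [hf.map_inf, hf.map_sup, hf.map_dneg, hB.dneg_sup])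
  dneg_tilde a := hf.injective (by
    simp only [hf.map_tilde, hf.map_minus, hf.map_dneg, hB.dneg_tilde])
  dneg_mul a b := hf.injective (by
    simp only [dsum, hf.map_tilde, hf.map_minus, hf.map_dneg, hf.map_mul, hB.dneg_mul])

end IsQRAEmbedding

/-! ### Adding bounds to an algebra -/

/-- The algebra `A` with a new least element, absorbing for the product, and a new greatest
element, absorbing for products with elements other than the least one. -/
inductive Bounded (A : Type u) : Type u where
  | bot
  | mid (a : A)
  | top

namespace Bounded

variable {A : Type u} [QRAOps A]

/-- In the product, `bot` is matched before `top`, so `bot` also absorbs `top`, as the lower of two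
opposite elements does in a Sugihara chain. -/
instance : QRAOps (Bounded A) where
  min
    | mid a, mid b => mid (a ⊓ b)
    | bot, _ => bot
    | _, bot => bot
    | top, b => b
    | a, top => a
  max
    | mid a, mid b => mid (a ⊔ b)
    | top, _ => top
    | _, top => top
    | bot, b => b
    | a, bot => a
  mul
    | mid a, mid b => mid (a * b)
    | bot, _ => bot
    | _, bot => bot
    | top, _ => top
    | _, top => top
  one := mid 1
  zero := mid 0
  tilde
    | bot => top
    | mid a => mid (tilde a)
    | top => bot
  minus
    | bot => top
    | mid a => mid (minus a)
    | top => bot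
  dneg
    | bot => top
    | mid a => mid (dneg a)
    | top => bot

end Bounded

/-! ### The padded frame -/

namespace RelFrame

variable {X : Type w} [PartialOrder X]

/-- The set `X` together with two lower and two upper points for each element of `Option (X / E)`,
that is, for each block of `E` and for one additional block. -/
inductive Padded (F : RelFrame X) : Type w where
  | base (x : X)
  /-- the copy `copy` of the upper or lower point of the block `c` -/
  | pt (c : Option (Quotient F.E)) (upper copy : Bool)

namespace Padded

variable {F : RelFrame X}

/-- The block of a point. -/
def block : Padded F → Option (Quotient F.E)
  | base x => some (Quotient.mk F.E x)
  | pt c _ _ => c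

/-- The extension of a relation on `X` by the pairs of distinct levels (in increasing order) and
the diagonal of the new points, all within blocks. -/
def pad (R : X → X → Prop) : Padded F → Padded F → Prop
  | base x, base y => R x y
  | base x, pt c t _ => some (Quotient.mk F.E x) = c ∧ t = true
  | pt c t _, base y => c = some (Quotient.mk F.E y) ∧ t = false
  | pt c t i, pt c' t' i' => c = c' ∧ ((t = false ∧ t' = true) ∨ (t = t' ∧ i = i'))

lemma block_base_eq {x y : X} :
    (some (Quotient.mk F.E x) : Option (Quotient F.E)) = some (Quotient.mk F.E y) ↔ F.E x y := by
  rw [Option.some_inj]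
  exact Quotient.eq

/-- Being the padding of the order of `X`, this order makes padding preserve `1`. The two copies on
a level are incomparable. -/
instance : PartialOrder (Padded F) where
  le := pad (· ≤ ·)
  le_refl
    | base x => le_refl x
    | pt _ _ _ => ⟨rfl, Or.inr ⟨rfl, rfl⟩⟩
  le_trans := by
    rintro (x | ⟨c, t, i⟩) (y | ⟨d, s, j⟩) (z | ⟨e, r, k⟩) h₁ h₂ <;> simp only [pad] at h₁ h₂ ⊢
    · exact h₁.trans h₂
    · exact ⟨(block_base_eq.2 (F.le_sub _ _ h₁)).trans h₂.1, h₂.2⟩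
    · simp_all
    · grind
    · exact ⟨h₁.1.trans (block_base_eq.2 (F.le_sub _ _ h₂)), h₁.2⟩
    · grind
    · grind
    · grind
  le_antisymm := by
    rintro (x | ⟨c, t, i⟩) (y | ⟨d, s, j⟩) h₁ h₂ <;> simp only [pad] at h₁ h₂
    · exact congrArg base (le_antisymm h₁ h₂)
    · simp_all
    · simp_all
    · grind

lemma le_def (p q : Padded F) : p ≤ q ↔ pad (· ≤ ·) p q := Iff.rfl

lemma block_eq_of_pad {R : X → X → Prop} (hR : ∀ x y, R x y → F.E x y) :
    ∀ p q : Padded F, pad R p q → p.block = q.block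
  | base _, base _, h => block_base_eq.2 (hR _ _ h)
  | base _, pt _ _ _, h => h.1
  | pt _ _ _, base _, h => h.1
  | pt _ _ _, pt _ _ _, h => h.1

/-- The automorphism `α` on the padded poset, exchanging the copies of the new points. -/
def alpha (f : X → X) : Padded F → Padded F
  | base x => base (f x)
  | pt c t i => pt c t (!i)

/-- The dual automorphism `β` on the padded poset, exchanging upper and lower points. -/
def beta : Padded F → Padded F
  | base x => base (F.β x)
  | pt c t i => pt c (!t) i

lemma mk_α (x : X) : Quotient.mk F.E (F.α x) = Quotient.mk F.E x :=
  Quotient.sound (F.E.symm (F.α_sub x))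

lemma mk_β (x : X) : Quotient.mk F.E (F.β x) = Quotient.mk F.E x :=
  Quotient.sound (F.E.symm (F.β_sub x))

lemma mk_α_symm (x : X) : Quotient.mk F.E (F.α.symm x) = Quotient.mk F.E x :=
  Quotient.sound (F.E.symm (α_symm_sub x))

/-- The frame on the padded poset. -/
def frame (F : RelFrame X) : RelFrame (Padded F) where
  E := Setoid.ker block
  le_sub := block_eq_of_pad F.le_sub
  α :=
    { toFun := alpha F.α
      invFun := alpha F.α.symm
      left_inv := by rintro (x | ⟨c, t, i⟩) <;> simp [alpha]
      right_inv := by rintro (x | ⟨c, t, i⟩) <;> simp [alpha]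
      map_rel_iff' := by
        rintro (x | ⟨c, t, i⟩) (y | ⟨d, s, j⟩) <;> simp [alpha, le_def, pad, mk_α] }
  β := beta
  β_β := by rintro (x | ⟨c, t, i⟩) <;> simp [beta, F.β_β]
  β_anti := by
    rintro (x | ⟨c, t, i⟩) (y | ⟨d, s, j⟩) h <;> simp only [beta, le_def, pad, mk_β] at h ⊢
    · exact F.β_anti _ _ h
    · simp [h.1, h.2]
    · simp [h.1, h.2]
    · grind
  α_sub := by
    rintro (x | ⟨c, t, i⟩)
    · exact block_base_eq.2 (F.α_sub x)
    · rfl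
  β_sub := by
    rintro (x | ⟨c, t, i⟩)
    · exact block_base_eq.2 (F.β_sub x)
    · rfl
  graph_β := by
    ext ⟨p, q⟩
    simp only [SetRel.comp, Function.graph, Set.mem_ofPred_eq, exists_eq_left', RelIso.coe_fn_mk,
      Equiv.coe_fn_mk]
    rw [show alpha F.α (beta (alpha F.α p)) = beta p from ?_]
    rcases p with x | ⟨c, t, i⟩
    · exact congrArg base (α_β_α x)
    -- The two swaps of copies by `α` cancel, as `β` does not touch the copy.
    · simp [alpha, beta]

instance [Finite X] : Finite (Padded F) :=
  Finite.of_injective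
    (β := X ⊕ (Option (Quotient F.E) × Bool × Bool))
    (fun | base x => Sum.inl x | pt c t i => Sum.inr (c, t, i))
    (by rintro (x | ⟨c, t, i⟩) (y | ⟨d, s, j⟩) h <;> simp_all)

/-- The extension of an element of `Dq(E)` to the padded frame. -/
def lift (R : F.Dq) : (frame F).Dq where
  rel := {p | pad R.Holds p.1 p.2}
  sub p h := block_eq_of_pad (fun _ _ => Dq.Holds.E) _ _ h
  up := by
    rintro ⟨p, q⟩ h ⟨p', q'⟩ - ⟨hp, hq⟩
    change pad _ _ _ at h
    change p' ≤ p at hp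
    change q ≤ q' at hq
    change pad _ p' q'
    -- Closure is checked on each side separately. Only triples inside `X` use that `R` is an
    -- up-set; the others depend on levels, blocks and copies.
    have key : ∀ p q r : Padded F, p ≤ q → pad R.Holds q r → pad R.Holds p r := by
      rintro (x | ⟨c, t, i⟩) (y | ⟨d, s, j⟩) (z | ⟨e, r, k⟩) h₁ h₂ <;>
        simp only [pad, le_def] at h₁ h₂ ⊢
      · exact h₂.mono h₁ le_rfl
      · exact ⟨(block_base_eq.2 (F.le_sub _ _ h₁)).trans h₂.1, h₂.2⟩
      · simp_all
      · grind
      · exact ⟨h₁.1.trans (block_base_eq.2 h₂.E), h₁.2⟩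
      · grind
      · grind
      · grind
    have key' : ∀ p q r : Padded F, pad R.Holds p q → q ≤ r → pad R.Holds p r := by
      rintro (x | ⟨c, t, i⟩) (y | ⟨d, s, j⟩) (z | ⟨e, r, k⟩) h₁ h₂ <;>
        simp only [pad, le_def] at h₁ h₂ ⊢
      · exact h₁.mono le_rfl h₂
      · exact ⟨(block_base_eq.2 h₁.E).trans h₂.1, h₂.2⟩
      · simp_all
      · grind
      · exact ⟨h₁.1.trans (block_base_eq.2 (F.le_sub _ _ h₂)), h₁.2⟩
      · grind
      · grind
      · grind
    exact key' _ _ _ (key _ _ _ hp h) hq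

/-! ### Representing an algebra with added bounds -/

/-- The map `A[⊥, ⊤] → Dq` over the padded frame induced by a map `A → Dq(E)`. -/
def extend {A : Type u} (φ : A → F.Dq) : Bounded A → (frame F).Dq
  | .bot => ⟨∅, fun _ h => h.elim, fun _ h => h.elim⟩
  | .mid a => lift (φ a)
  | .top => ⟨{p | p.1.block = p.2.block}, fun _ h => h, fun _ _ _ h _ => h⟩

variable {A : Type u} (φ : A → F.Dq)

lemma extend_mid (a : A) (p q : Padded F) :
    (extend φ (.mid a)).Holds p q ↔ pad (φ a).Holds p q := Iff.rfl

/-- The upper points give each point of `X` a successor even if `R` is empty, and new points are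
their own successors. This yields `mid a * top = top`. -/
lemma exists_pad_right (R : X → X → Prop) (p : Padded F) :
    ∃ q, pad R p q ∧ p.block = q.block := by
  rcases p with x | ⟨c, t, i⟩
  · exact ⟨pt (some (Quotient.mk F.E x)) true true, by simp [pad, block]⟩
  · exact ⟨pt c t i, by simp [pad]⟩

lemma exists_pad_left (R : X → X → Prop) (q : Padded F) :
    ∃ p, pad R p q ∧ p.block = q.block := by
  rcases q with x | ⟨c, t, i⟩
  · exact ⟨pt (some (Quotient.mk F.E x)) false true, by simp [pad, block]⟩
  · exact ⟨pt c t i, by simp [pad]⟩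

/-- From `X` a padded relation leaves only to upper points, from which there is no return, so a
two-step path between points of `X` stays in `X`. For the other pairs a new endpoint serves as the
intermediate point, by the diagonal. -/
lemma pad_comp {R S : X → X → Prop} (hR : ∀ x y, R x y → F.E x y) (hS : ∀ x y, S x y → F.E x y)
    (p q : Padded F) :
    pad (fun x y => ∃ z, R x z ∧ S z y) p q ↔ ∃ r, pad R p r ∧ pad S r q := by
  constructor
  · rcases p with x | ⟨c, t, i⟩ <;> rcases q with y | ⟨d, s, j⟩ <;> simp only [pad]
    · rintro ⟨z, h₁, h₂⟩
      exact ⟨base z, h₁, h₂⟩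
    · rintro ⟨rfl, rfl⟩
      exact ⟨pt (some (Quotient.mk F.E x)) true j, by simp⟩
    · rintro ⟨rfl, rfl⟩
      exact ⟨pt (some (Quotient.mk F.E y)) false i, by simp⟩
    · rintro ⟨rfl, h⟩
      exact ⟨pt c t i, by simpa [pad] using h⟩
  · rintro ⟨r, h₁, h₂⟩
    have e₁ := block_eq_of_pad hR _ _ h₁
    have e₂ := block_eq_of_pad hS _ _ h₂
    rcases p with x | ⟨c, t, i⟩ <;> rcases q with y | ⟨d, s, j⟩ <;>
      rcases r with z | ⟨e, r, k⟩ <;> simp only [pad, block] at h₁ h₂ e₁ e₂ ⊢ <;> grind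

variable [QRAOps A] {φ}

/-- If `A` embeds in `Dq(E)`, then `A` with two bounds added embeds in the algebra of the padded
frame. -/
theorem isQRAEmbedding_extend (hφ : IsQRAEmbedding φ) : IsQRAEmbedding (extend φ) where
  injective := by
    -- The extra block `none` separates the three kinds: a diagonal pair lies in `mid a` but not in
    -- `bot`, and an upper-to-lower pair lies in `top` but not in `mid a`.
    have h₀ : ∀ p : Padded F, ¬ (extend φ .bot).Holds p p := fun _ h => h
    have h₁ : ∀ a t, (extend φ (.mid a)).Holds (pt none t true) (pt none t true) :=
      fun a t => by simp [extend_mid, pad]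
    have h₂ : ∀ a, ¬ (extend φ (.mid a)).Holds (pt none true true) (pt none false true) :=
      fun a => by simp [extend_mid, pad]
    have h₃ : ∀ t t', (extend φ .top).Holds (pt none t true) (pt none t' true) := fun _ _ => rfl
    rintro (_ | a | _) (_ | b | _) h
    · rfl
    · exact (h₀ _ (h ▸ h₁ b true)).elim
    · exact (h₀ _ (h ▸ h₃ true true)).elim
    · exact (h₀ _ (h ▸ h₁ a true)).elim
    · refine congrArg _ (hφ.injective (Dq.ext_holds fun x y => ?_))
      change (extend φ (.mid a)).Holds (base x) (base y) ↔ _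
      rw [h]
      rfl
    · exact (h₂ a (h ▸ h₃ true false)).elim
    · exact (h₀ _ (h ▸ h₃ true true)).elim
    · exact (h₂ b (h ▸ h₃ true false)).elim
    · rfl
  map_inf := by
    rintro (_ | a | _) (_ | b | _) <;> refine Dq.ext_holds fun p q => ?_
    · exact ⟨False.elim, And.left⟩
    · exact ⟨False.elim, And.left⟩
    · exact ⟨False.elim, And.left⟩
    · exact ⟨False.elim, And.right⟩
    · change pad (φ (a ⊓ b)).Holds p q ↔ pad (φ a).Holds p q ∧ pad (φ b).Holds p q
      rw [hφ.map_inf]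
      rcases p with x | ⟨c, t, i⟩ <;> rcases q with y | ⟨d, s, j⟩ <;>
        simp only [pad, Dq.holds_inf, and_self]
    · exact ⟨fun h => ⟨h, Dq.Holds.E h⟩, And.left⟩
    · exact ⟨False.elim, And.right⟩
    · exact ⟨fun h => ⟨Dq.Holds.E h, h⟩, And.right⟩
    · exact ⟨fun h => ⟨h, h⟩, And.left⟩
  map_sup := by
    rintro (_ | a | _) (_ | b | _) <;> refine Dq.ext_holds fun p q => ?_
    · exact ⟨Or.inl, fun h => h.elim id id⟩
    · exact ⟨Or.inr, fun h => h.elim False.elim id⟩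
    · exact ⟨Or.inr, fun h => h.elim False.elim id⟩
    · exact ⟨Or.inl, fun h => h.elim id False.elim⟩
    · change pad (φ (a ⊔ b)).Holds p q ↔ pad (φ a).Holds p q ∨ pad (φ b).Holds p q
      rw [hφ.map_sup]
      rcases p with x | ⟨c, t, i⟩ <;> rcases q with y | ⟨d, s, j⟩ <;>
        simp only [pad, Dq.holds_sup, or_self]
    · exact ⟨Or.inr, fun h => h.elim Dq.Holds.E id⟩
    · exact ⟨Or.inl, fun h => h.elim id False.elim⟩
    · exact ⟨Or.inl, fun h => h.elim id Dq.Holds.E⟩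
    · exact ⟨Or.inl, fun h => h.elim id id⟩
  map_mul := by
    rintro (_ | a | _) (_ | b | _) <;> refine Dq.ext_holds fun p q => ?_
    · exact ⟨False.elim, fun ⟨_, h, _⟩ => h⟩
    · exact ⟨False.elim, fun ⟨_, h, _⟩ => h⟩
    · exact ⟨False.elim, fun ⟨_, h, _⟩ => h⟩
    · exact ⟨False.elim, fun ⟨_, _, h⟩ => h⟩
    · change pad (φ (a * b)).Holds p q ↔ ∃ r, pad (φ a).Holds p r ∧ pad (φ b).Holds r q
      rw [hφ.map_mul]
      exact pad_comp (fun _ _ => Dq.Holds.E) (fun _ _ => Dq.Holds.E) p q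
    · refine ⟨fun h => ?_, fun ⟨r, h₁, h₂⟩ => (Dq.Holds.E h₁).trans h₂⟩
      obtain ⟨r, h₁, h₂⟩ := exists_pad_right (φ a).Holds p
      exact ⟨r, h₁, h₂.symm.trans h⟩
    · exact ⟨False.elim, fun ⟨_, _, h⟩ => h⟩
    · refine ⟨fun h => ?_, fun ⟨r, h₁, h₂⟩ => Eq.trans h₁ (Dq.Holds.E h₂)⟩
      obtain ⟨r, h₁, h₂⟩ := exists_pad_left (φ b).Holds q
      exact ⟨r, Eq.trans h h₂.symm, h₁⟩
    · exact ⟨fun h => ⟨p, rfl, h⟩, fun ⟨r, h₁, h₂⟩ => Eq.trans h₁ h₂⟩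
  map_tilde := by
    rintro (_ | a | _) <;> refine Dq.ext_holds fun p q => ?_ <;> rw [Dq.holds_tilde]
    · exact ⟨fun h => ⟨h, id⟩, And.left⟩
    · change pad (φ (tilde a)).Holds p q ↔
        p.block = q.block ∧ ¬ pad (φ a).Holds (alpha F.α.symm q) p
      rw [hφ.map_tilde]
      rcases p with x | ⟨c, t, i⟩ <;> rcases q with y | ⟨d, s, j⟩ <;>
        simp only [pad, alpha, block, Dq.holds_tilde, block_base_eq, mk_α_symm]
      any_goals grind
      -- Two new points: on one level, off-diagonal followed by the swap of copies is the diagonal.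
      cases i <;> cases j <;> grind
    · exact ⟨False.elim, fun h => h.2 (E_α_symm_left.2 (Setoid.symm' _ h.1))⟩
  map_minus := by
    rintro (_ | a | _) <;> refine Dq.ext_holds fun p q => ?_ <;> rw [Dq.holds_minus]
    · exact ⟨fun h => ⟨h, id⟩, And.left⟩
    · change pad (φ (minus a)).Holds p q ↔
        p.block = q.block ∧ ¬ pad (φ a).Holds q (alpha F.α p)
      rw [hφ.map_minus]
      rcases p with x | ⟨c, t, i⟩ <;> rcases q with y | ⟨d, s, j⟩ <;>
        simp only [pad, alpha, block, Dq.holds_minus, block_base_eq, mk_α]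
      any_goals grind
      cases i <;> cases j <;> grind
    · exact ⟨False.elim, fun h => h.2 (E_α_right.2 (Setoid.symm' _ h.1))⟩
  map_dneg := by
    rintro (_ | a | _) <;> refine Dq.ext_holds fun p q => ?_ <;> rw [Dq.holds_dneg]
    · exact ⟨fun h => ⟨h, id⟩, And.left⟩
    · change pad (φ (dneg a)).Holds p q ↔
        p.block = q.block ∧ ¬ pad (φ a).Holds (beta (alpha F.α p)) (beta q)
      rw [hφ.map_dneg]
      rcases p with x | ⟨c, t, i⟩ <;> rcases q with y | ⟨d, s, j⟩ <;>
        simp only [pad, alpha, beta, block, Dq.holds_dneg, block_base_eq, mk_α, mk_β]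
      any_goals grind
      -- As for `∼`, with both points moved to the opposite level by `β`; `α` swaps the copy of only
      -- the first.
      cases i <;> cases j <;> grind
    · exact ⟨False.elim, fun h => h.2 (E_β_left.2 (E_α_left.2 (E_β_right.2 h.1)))⟩
  map_one := by
    refine Dq.ext_holds fun p q => ?_
    change pad (φ 1).Holds p q ↔ pad (· ≤ ·) p q
    rw [hφ.map_one]
    rfl
  map_zero := by
    refine Dq.ext_holds fun p q => ?_
    change pad (φ 0).Holds p q ↔ (0 : (frame F).Dq).Holds p q
    rw [hφ.map_zero, Dq.holds_zero]
    change _ ↔ p.block = q.block ∧ ¬ pad (· ≤ ·) q (alpha F.α p)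
    rcases p with x | ⟨c, t, i⟩ <;> rcases q with y | ⟨d, s, j⟩ <;>
      simp only [pad, alpha, block, Dq.holds_zero, block_base_eq, mk_α]
    any_goals grind
    cases i <;> cases j <;> grind

end Padded

end RelFrame

/-! ### Arithmetic of odd Sugihara chains -/

namespace OddSugiharaChain

variable {n : ℕ}

lemma ne_one_iff {a : OddSugiharaChain n} : a ≠ 1 ↔ a.idx ≠ 0 :=
  not_congr OddSugiharaChain.ext_iff

lemma idx_one : (1 : OddSugiharaChain n).idx = 0 := rfl
lemma idx_inf (a b : OddSugiharaChain n) : (a ⊓ b).idx = min a.idx b.idx := rfl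
lemma idx_sup (a b : OddSugiharaChain n) : (a ⊔ b).idx = max a.idx b.idx := rfl
lemma idx_mul (a b : OddSugiharaChain n) : (a * b).idx = mulIdx a.idx b.idx := rfl

lemma one_below_iff (a : OddSugiharaChain n) : Below 1 a ↔ 0 ≤ a.idx := by
  rw [Below, OddSugiharaChain.ext_iff, idx_inf, idx_one, min_eq_left_iff]

lemma below_one_iff (a : OddSugiharaChain n) : Below a 1 ↔ a.idx ≤ 0 := by
  rw [Below, OddSugiharaChain.ext_iff, idx_inf, idx_one, min_eq_left_iff]

lemma mulIdx_left {i j : ℤ} (h : |j| < |i|) : mulIdx i j = i := if_pos h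

lemma mulIdx_right {i j : ℤ} (h : |i| < |j|) : mulIdx i j = j := by
  rw [mulIdx, if_neg h.not_gt, if_pos h]

lemma mulIdx_of_abs_eq {i j : ℤ} (h : |i| = |j|) : mulIdx i j = min i j := by
  rw [mulIdx, if_neg h.not_gt, if_neg h.not_lt]

lemma mul_one' (a : OddSugiharaChain n) : a * 1 = a := by
  rw [OddSugiharaChain.ext_iff, idx_mul, idx_one]
  rcases eq_or_ne a.idx 0 with h | h
  · rw [h]
    rfl
  · exact mulIdx_left (by simpa using h)

lemma one_mul' (a : OddSugiharaChain n) : 1 * a = a := by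
  rw [OddSugiharaChain.ext_iff, idx_mul, idx_one]
  rcases eq_or_ne a.idx 0 with h | h
  · rw [h]
    rfl
  · exact mulIdx_right (by simpa using h)

lemma tilde_ne_one {a : OddSugiharaChain n} (h : a ≠ 1) : tilde a ≠ 1 :=
  fun h' => h ((oneTotallyIrreducible n).tilde a h')

lemma minus_ne_one {a : OddSugiharaChain n} (h : a ≠ 1) : minus a ≠ 1 :=
  fun h' => h ((oneTotallyIrreducible n).minus a h')

lemma dneg_ne_one {a : OddSugiharaChain n} (h : a ≠ 1) : dneg a ≠ 1 :=
  fun h' => h ((oneTotallyIrreducible n).dneg a h')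

end OddSugiharaChain

/-! ### Operations of `S_n[L]` -/

namespace NestedSum

open OddSugiharaChain

lemma ofK_of_ne {K : Type u} {L : Type v} [QRAOps K] [QRAOps L] {k : K} (hk : k ≠ 1) :
    (ofK k : NestedSum K L) = outer k hk := dif_neg hk

variable {n m : ℕ} {L : Type u} [QRAOps L]

open Classical in
lemma outer_inf_inner (k : OddSugiharaChain n) (hk : k ≠ 1) (l : L) :
    outer k hk ⊓ inner l = if 0 ≤ k.idx then inner l else outer k hk := by
  change (if Below 1 k then inner l else ofK (k ⊓ 1)) = _
  simp only [one_below_iff]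
  split_ifs with h
  · rfl
  · rw [show k ⊓ 1 = k from (below_one_iff k).2 (by omega), ofK_of_ne hk]

lemma inner_inf_outer (k : OddSugiharaChain n) (hk : k ≠ 1) (l : L) :
    inner l ⊓ outer k hk = if 0 ≤ k.idx then inner l else outer k hk := outer_inf_inner k hk l

open Classical in
lemma outer_sup_inner (k : OddSugiharaChain n) (hk : k ≠ 1) (l : L) :
    outer k hk ⊔ inner l = if k.idx ≤ 0 then inner l else outer k hk := by
  change (if Below k 1 then inner l else ofK (k ⊔ 1)) = _
  simp only [below_one_iff]
  split_ifs with h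
  · rfl
  · rw [show k ⊔ 1 = k from OddSugiharaChain.ext (max_eq_left (by rw [idx_one]; omega)),
      ofK_of_ne hk]

lemma inner_sup_outer (k : OddSugiharaChain n) (hk : k ≠ 1) (l : L) :
    inner l ⊔ outer k hk = if k.idx ≤ 0 then inner l else outer k hk := outer_sup_inner k hk l

lemma outer_mul_inner (k : OddSugiharaChain n) (hk : k ≠ 1) (l : L) :
    outer k hk * inner l = outer k hk := by
  change ofK (k * 1) = _
  rw [mul_one', ofK_of_ne hk]

lemma inner_mul_outer (k : OddSugiharaChain n) (hk : k ≠ 1) (l : L) :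
    inner l * outer k hk = outer k hk := by
  change ofK (1 * k) = _
  rw [one_mul', ofK_of_ne hk]

/-- In `k \ 0` the constant `0` of `L` counts as the identity of the chain, and `-1 = 1` there. -/
lemma tilde_outer (k : OddSugiharaChain n) (hk : k ≠ 1) :
    tilde (outer k hk : NestedSum _ L) = outer (tilde k) (tilde_ne_one hk) := by
  change ofK (tilde (minus (1 : OddSugiharaChain n) * k)) = _
  rw [show minus (1 : OddSugiharaChain n) = 1 from rfl, one_mul', ofK_of_ne]

lemma minus_outer (k : OddSugiharaChain n) (hk : k ≠ 1) :
    minus (outer k hk : NestedSum _ L) = outer (minus k) (minus_ne_one hk) := by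
  change ofK (minus (k * tilde (1 : OddSugiharaChain n))) = _
  rw [show tilde (1 : OddSugiharaChain n) = 1 from rfl, mul_one', ofK_of_ne]

lemma dneg_outer (k : OddSugiharaChain n) (hk : k ≠ 1) :
    dneg (outer k hk : NestedSum _ L) = outer (dneg k) (dneg_ne_one hk) :=
  ofK_of_ne _

/-- In a DqRA `-0 = -∼1 = 1`, so `l \ 0 = ∼(-0 · l)` is `∼l`. -/
lemma tilde_inner (hL : IsDqRA L) (l : L) :
    tilde (inner l : NestedSum (OddSugiharaChain n) L) = inner (tilde l) := by
  change inner (tilde (minus 0 * l)) = _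
  rw [← hL.tilde_one, hL.minus_tilde, hL.one_mul]

lemma minus_inner (hL : IsDqRA L) (l : L) :
    minus (inner l : NestedSum (OddSugiharaChain n) L) = inner (minus l) := by
  change inner (minus (l * tilde 0)) = _
  rw [← hL.minus_one, hL.tilde_minus, hL.mul_one]

/-! ### The base case: `S_1[L]` is `L` -/

/-- The retraction of `S_1[L]` onto `L`. -/
def toInner : NestedSum (OddSugiharaChain 1) L → L
  | outer _ _ => 1
  | inner l => l

/-- The index bound is `1 / 2 = 0`. Hence `S_1[L]` has no outer elements, and the value of `toInner`
on them is immaterial. -/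
lemma eq_one (k : OddSugiharaChain 1) : k = 1 :=
  OddSugiharaChain.ext (abs_eq_zero.1 (le_antisymm k.abs_idx_le (abs_nonneg _)))

theorem isQRAEmbedding_toInner (hL : IsDqRA L) :
    IsQRAEmbedding (toInner : NestedSum (OddSugiharaChain 1) L → L) where
  injective := by
    rintro (⟨k, hk⟩ | a) (⟨k', hk'⟩ | b) h
    exacts [(hk (eq_one k)).elim, (hk (eq_one k)).elim, (hk' (eq_one k')).elim, congrArg inner h]
  map_inf := by
    rintro (⟨k, hk⟩ | a) (⟨k', hk'⟩ | b)
    exacts [(hk (eq_one k)).elim, (hk (eq_one k)).elim, (hk' (eq_one k')).elim, rfl]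
  map_sup := by
    rintro (⟨k, hk⟩ | a) (⟨k', hk'⟩ | b)
    exacts [(hk (eq_one k)).elim, (hk (eq_one k)).elim, (hk' (eq_one k')).elim, rfl]
  map_mul := by
    rintro (⟨k, hk⟩ | a) (⟨k', hk'⟩ | b)
    exacts [(hk (eq_one k)).elim, (hk (eq_one k)).elim, (hk' (eq_one k')).elim, rfl]
  map_tilde := by
    rintro (⟨k, hk⟩ | a)
    exacts [(hk (eq_one k)).elim, congrArg toInner (tilde_inner hL a)]
  map_minus := by
    rintro (⟨k, hk⟩ | a)
    exacts [(hk (eq_one k)).elim, congrArg toInner (minus_inner hL a)]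
  map_dneg := by
    rintro (⟨k, hk⟩ | a)
    exacts [(hk (eq_one k)).elim, rfl]
  map_one := rfl
  map_zero := rfl

/-! ### The inductive step: the extremes of the longer chain as added bounds -/

/-- The image in `S_m[L]`, with two bounds added, of an element of index `i` of a longer chain. -/
noncomputable def boundedOfIdx (m : ℕ) (L : Type u) [QRAOps L] (i : ℤ) :
    Bounded (NestedSum (OddSugiharaChain m) L) :=
  if h : |i| ≤ ((m / 2 : ℕ) : ℤ) then .mid (ofK ⟨i, h⟩) else if 0 < i then .top else .bot

/-- The map collapsing the bounds of `S_n[L]` onto the added bounds of `S_m[L]`. -/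
noncomputable def toBounded (n m : ℕ) (L : Type u) [QRAOps L] :
    NestedSum (OddSugiharaChain n) L → Bounded (NestedSum (OddSugiharaChain m) L)
  | outer k _ => boundedOfIdx m L k.idx
  | inner l => .mid (inner l)

lemma boundedOfIdx_top : boundedOfIdx m L (((m / 2 : ℕ) : ℤ) + 1) = .top := by
  rw [boundedOfIdx, dif_neg (by rw [abs_of_nonneg] <;> omega), if_pos (by omega)]

lemma boundedOfIdx_bot : boundedOfIdx m L (-(((m / 2 : ℕ) : ℤ) + 1)) = .bot := by
  rw [boundedOfIdx, dif_neg (by rw [abs_neg, abs_of_nonneg] <;> omega), if_neg (by omega)]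

lemma boundedOfIdx_mid (k : OddSugiharaChain m) : boundedOfIdx m L k.idx = .mid (ofK k) :=
  dif_pos k.abs_idx_le

/-- Including `k = 1`, where both sides give the identity of `L`, saves showing that meets, joins
and products of outer elements avoid `1`. -/
lemma toBounded_ofK (k : OddSugiharaChain n) : toBounded n m L (ofK k) = boundedOfIdx m L k.idx := by
  by_cases hk : k = 1
  · subst hk
    rw [show (ofK 1 : NestedSum (OddSugiharaChain n) L) = inner 1 from dif_pos rfl]
    exact ((boundedOfIdx_mid (1 : OddSugiharaChain m)).trans
      (congrArg Bounded.mid (dif_pos rfl))).symm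
  · rw [ofK_of_ne hk]
    rfl

/-- The longer chain has just one more index at each end, so each nonzero index is extreme or
already belongs to the shorter chain. -/
lemma boundedOfIdx_cases (L : Type u) [QRAOps L] (hnm : n / 2 = m / 2 + 1)
    (k : OddSugiharaChain n) (hk : k ≠ 1) :
    (k.idx = ((m / 2 : ℕ) : ℤ) + 1 ∧ boundedOfIdx m L k.idx = .top) ∨
    (k.idx = -(((m / 2 : ℕ) : ℤ) + 1) ∧ boundedOfIdx m L k.idx = .bot) ∨
    ∃ (p : OddSugiharaChain m) (hp : p ≠ 1), k.idx = p.idx ∧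
      boundedOfIdx m L k.idx = .mid (outer p hp) ∧
      -(((m / 2 : ℕ) : ℤ) + 1) < k.idx ∧ k.idx < ((m / 2 : ℕ) : ℤ) + 1 := by
  have h := abs_le.1 k.abs_idx_le
  have hk' := ne_one_iff.1 hk
  by_cases h₁ : k.idx = ((m / 2 : ℕ) : ℤ) + 1
  · exact Or.inl ⟨h₁, by rw [h₁, boundedOfIdx_top]⟩
  by_cases h₂ : k.idx = -(((m / 2 : ℕ) : ℤ) + 1)
  · exact Or.inr (Or.inl ⟨h₂, by rw [h₂, boundedOfIdx_bot]⟩)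
  have h₃ : |k.idx| ≤ ((m / 2 : ℕ) : ℤ) := abs_le.2 (by omega)
  have hp : (⟨k.idx, h₃⟩ : OddSugiharaChain m) ≠ 1 := ne_one_iff.2 hk'
  refine Or.inr (Or.inr ⟨⟨k.idx, h₃⟩, hp, rfl, ?_, by omega, by omega⟩)
  exact (boundedOfIdx_mid _).trans (congrArg Bounded.mid (ofK_of_ne hp))

/-- The extremes have the largest absolute value, so they absorb everything strictly between them,
as the added bounds do. -/
lemma mulIdx_extreme_left {i j M : ℤ} (hi : i = M ∨ i = -M) (h₁ : -M < j) (h₂ : j < M) :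
    mulIdx i j = i := by
  have h : |j| < M := abs_lt.2 ⟨h₁, h₂⟩
  exact mulIdx_left (by rwa [(abs_eq ((abs_nonneg j).trans h.le)).2 hi])

lemma mulIdx_extreme_right {i j M : ℤ} (hj : j = M ∨ j = -M) (h₁ : -M < i) (h₂ : i < M) :
    mulIdx i j = j := by
  have h : |i| < M := abs_lt.2 ⟨h₁, h₂⟩
  exact mulIdx_right (by rwa [(abs_eq ((abs_nonneg i).trans h.le)).2 hj])

lemma mulIdx_extreme {i j M : ℤ} (hi : i = M ∨ i = -M) (hj : j = M ∨ j = -M) :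
    mulIdx i j = min i j :=
  mulIdx_of_abs_eq (by rcases hi with rfl | rfl <;> rcases hj with rfl | rfl <;> simp)

/-- `S_{n+2}[L]` embeds in the algebra `S_n[L]` with two bounds added. -/
theorem isQRAEmbedding_toBounded (hL : IsDqRA L) (hnm : n / 2 = m / 2 + 1) :
    IsQRAEmbedding (toBounded n m L) where
  injective := by
    rintro (⟨k, hk⟩ | a) (⟨k', hk'⟩ | b) h
    · change boundedOfIdx m L k.idx = boundedOfIdx m L k'.idx at h
      have : k.idx = k'.idx := by
        rcases boundedOfIdx_cases L hnm k hk with ⟨e, h₁⟩ | ⟨e, h₁⟩ | ⟨p, hp, e, h₁, -⟩ <;>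
        rcases boundedOfIdx_cases L hnm k' hk' with
          ⟨e', h₂⟩ | ⟨e', h₂⟩ | ⟨p', hp', e', h₂, -⟩ <;>
        rw [h₁, h₂] at h <;> cases h <;> rw [e, e']
      obtain rfl := OddSugiharaChain.ext this
      rfl
    · change boundedOfIdx m L k.idx = .mid (inner b) at h
      rcases boundedOfIdx_cases L hnm k hk with ⟨e, h₁⟩ | ⟨e, h₁⟩ | ⟨p, hp, e, h₁, -⟩ <;>
        rw [h₁] at h <;> cases h
    · change .mid (inner a) = boundedOfIdx m L k'.idx at h
      rcases boundedOfIdx_cases L hnm k' hk' with ⟨e, h₁⟩ | ⟨e, h₁⟩ | ⟨p, hp, e, h₁, -⟩ <;>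
        rw [h₁] at h <;> cases h
    · exact congrArg inner (NestedSum.inner.inj (Bounded.mid.inj h))
  map_inf := by
    rintro (⟨k, hk⟩ | a) (⟨k', hk'⟩ | b)
    · change toBounded n m L (ofK (k ⊓ k')) = boundedOfIdx m L k.idx ⊓ boundedOfIdx m L k'.idx
      rw [toBounded_ofK, idx_inf]
      rcases boundedOfIdx_cases L hnm k hk with ⟨e, h₁⟩ | ⟨e, h₁⟩ | ⟨p, hp, e, h₁, _, _⟩ <;>
        rcases boundedOfIdx_cases L hnm k' hk' with
          ⟨e', h₂⟩ | ⟨e', h₂⟩ | ⟨p', hp', e', h₂, _, _⟩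
      -- Both elements come from the shorter chain, whose meet is given by the same formula on
      -- indices. In the other cases one element is extreme and decides the minimum.
      on_goal 9 =>
        rw [h₁, h₂, e, e']
        exact boundedOfIdx_mid (p ⊓ p')
      all_goals first
        | rw [min_eq_left (by omega), h₁, h₂]; rfl
        | rw [min_eq_right (by omega), h₁, h₂]; rfl
    · change toBounded n m L (outer k hk ⊓ inner b) = boundedOfIdx m L k.idx ⊓ .mid (inner b)
      rw [outer_inf_inner]
      rcases boundedOfIdx_cases L hnm k hk with ⟨e, h₁⟩ | ⟨e, h₁⟩ | ⟨p, hp, e, h₁, -⟩ <;> rw [h₁]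
      · rw [if_pos (by omega)]
        rfl
      · rw [if_neg (by omega)]
        exact h₁
      · change _ = Bounded.mid (outer p hp ⊓ inner b)
        rw [outer_inf_inner, e]
        split_ifs
        · rfl
        · exact h₁
    · change toBounded n m L (inner a ⊓ outer k' hk') = .mid (inner a) ⊓ boundedOfIdx m L k'.idx
      rw [inner_inf_outer]
      rcases boundedOfIdx_cases L hnm k' hk' with ⟨e, h₁⟩ | ⟨e, h₁⟩ | ⟨p, hp, e, h₁, -⟩ <;> rw [h₁]
      · rw [if_pos (by omega)]
        rfl
      · rw [if_neg (by omega)]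
        exact h₁
      · change _ = Bounded.mid (inner a ⊓ outer p hp)
        rw [inner_inf_outer, e]
        split_ifs
        · rfl
        · exact h₁
    · rfl
  map_sup := by
    rintro (⟨k, hk⟩ | a) (⟨k', hk'⟩ | b)
    · change toBounded n m L (ofK (k ⊔ k')) = boundedOfIdx m L k.idx ⊔ boundedOfIdx m L k'.idx
      rw [toBounded_ofK, idx_sup]
      rcases boundedOfIdx_cases L hnm k hk with ⟨e, h₁⟩ | ⟨e, h₁⟩ | ⟨p, hp, e, h₁, _, _⟩ <;>
        rcases boundedOfIdx_cases L hnm k' hk' with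
          ⟨e', h₂⟩ | ⟨e', h₂⟩ | ⟨p', hp', e', h₂, _, _⟩
      on_goal 9 =>
        rw [h₁, h₂, e, e']
        exact boundedOfIdx_mid (p ⊔ p')
      all_goals first
        | rw [max_eq_left (by omega), h₁, h₂]; rfl
        | rw [max_eq_right (by omega), h₁, h₂]; rfl
    · change toBounded n m L (outer k hk ⊔ inner b) = boundedOfIdx m L k.idx ⊔ .mid (inner b)
      rw [outer_sup_inner]
      rcases boundedOfIdx_cases L hnm k hk with ⟨e, h₁⟩ | ⟨e, h₁⟩ | ⟨p, hp, e, h₁, -⟩ <;> rw [h₁]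
      · rw [if_neg (by omega)]
        exact h₁
      · rw [if_pos (by omega)]
        rfl
      · change _ = Bounded.mid (outer p hp ⊔ inner b)
        rw [outer_sup_inner, e]
        split_ifs
        · rfl
        · exact h₁
    · change toBounded n m L (inner a ⊔ outer k' hk') = .mid (inner a) ⊔ boundedOfIdx m L k'.idx
      rw [inner_sup_outer]
      rcases boundedOfIdx_cases L hnm k' hk' with ⟨e, h₁⟩ | ⟨e, h₁⟩ | ⟨p, hp, e, h₁, -⟩ <;> rw [h₁]
      · rw [if_neg (by omega)]
        exact h₁
      · rw [if_pos (by omega)]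
        rfl
      · change _ = Bounded.mid (inner a ⊔ outer p hp)
        rw [inner_sup_outer, e]
        split_ifs
        · rfl
        · exact h₁
    · rfl
  map_mul := by
    rintro (⟨k, hk⟩ | a) (⟨k', hk'⟩ | b)
    · change toBounded n m L (ofK (k * k')) = boundedOfIdx m L k.idx * boundedOfIdx m L k'.idx
      rw [toBounded_ofK, idx_mul]
      rcases boundedOfIdx_cases L hnm k hk with ⟨e, h₁⟩ | ⟨e, h₁⟩ | ⟨p, hp, e, h₁, b₁, b₂⟩ <;>
        rcases boundedOfIdx_cases L hnm k' hk' with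
          ⟨e', h₂⟩ | ⟨e', h₂⟩ | ⟨p', hp', e', h₂, b₃, b₄⟩
      on_goal 9 =>
        rw [h₁, h₂, e, e']
        exact boundedOfIdx_mid (p * p')
      · rw [mulIdx_extreme (Or.inl e) (Or.inl e'), min_eq_left (by omega), h₁, h₂]
        rfl
      · rw [mulIdx_extreme (Or.inl e) (Or.inr e'), min_eq_right (by omega), h₁, h₂]
        rfl
      · rw [mulIdx_extreme_left (Or.inl e) b₃ b₄, h₁, h₂]
        rfl
      · rw [mulIdx_extreme (Or.inr e) (Or.inl e'), min_eq_left (by omega), h₁, h₂]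
        rfl
      · rw [mulIdx_extreme (Or.inr e) (Or.inr e'), min_eq_right (by omega), h₁, h₂]
        rfl
      · rw [mulIdx_extreme_left (Or.inr e) b₃ b₄, h₁, h₂]
        rfl
      · rw [mulIdx_extreme_right (Or.inl e') b₁ b₂, h₁, h₂]
        rfl
      · rw [mulIdx_extreme_right (Or.inr e') b₁ b₂, h₁, h₂]
        rfl
    · rw [outer_mul_inner]
      change boundedOfIdx m L k.idx = boundedOfIdx m L k.idx * .mid (inner b)
      rcases boundedOfIdx_cases L hnm k hk with ⟨e, h₁⟩ | ⟨e, h₁⟩ | ⟨p, hp, e, h₁, -⟩ <;> rw [h₁]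
      · rfl
      · rfl
      · exact congrArg Bounded.mid (outer_mul_inner p hp b).symm
    · rw [inner_mul_outer]
      change boundedOfIdx m L k'.idx = .mid (inner a) * boundedOfIdx m L k'.idx
      rcases boundedOfIdx_cases L hnm k' hk' with ⟨e, h₁⟩ | ⟨e, h₁⟩ | ⟨p, hp, e, h₁, -⟩ <;> rw [h₁]
      · rfl
      · rfl
      · exact congrArg Bounded.mid (inner_mul_outer p hp a).symm
    · rfl
  map_tilde := by
    rintro (⟨k, hk⟩ | a)
    · rw [tilde_outer]
      change boundedOfIdx m L (-k.idx) = tilde (boundedOfIdx m L k.idx)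
      rcases boundedOfIdx_cases L hnm k hk with ⟨e, h₁⟩ | ⟨e, h₁⟩ | ⟨p, hp, e, h₁, -⟩ <;> rw [h₁, e]
      · exact boundedOfIdx_bot
      · rw [neg_neg]
        exact boundedOfIdx_top
      · change _ = Bounded.mid (tilde (outer p hp))
        rw [tilde_outer, ← ofK_of_ne]
        exact boundedOfIdx_mid (tilde p)
    · rw [tilde_inner hL]
      exact congrArg Bounded.mid (tilde_inner hL a).symm
  map_minus := by
    rintro (⟨k, hk⟩ | a)
    · rw [minus_outer]
      change boundedOfIdx m L (-k.idx) = minus (boundedOfIdx m L k.idx)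
      rcases boundedOfIdx_cases L hnm k hk with ⟨e, h₁⟩ | ⟨e, h₁⟩ | ⟨p, hp, e, h₁, -⟩ <;> rw [h₁, e]
      · exact boundedOfIdx_bot
      · rw [neg_neg]
        exact boundedOfIdx_top
      · change _ = Bounded.mid (minus (outer p hp))
        rw [minus_outer, ← ofK_of_ne]
        exact boundedOfIdx_mid (minus p)
    · rw [minus_inner hL]
      exact congrArg Bounded.mid (minus_inner hL a).symm
  map_dneg := by
    rintro (⟨k, hk⟩ | a)
    · rw [dneg_outer]
      change boundedOfIdx m L (-k.idx) = dneg (boundedOfIdx m L k.idx)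
      rcases boundedOfIdx_cases L hnm k hk with ⟨e, h₁⟩ | ⟨e, h₁⟩ | ⟨p, hp, e, h₁, -⟩ <;> rw [h₁, e]
      · exact boundedOfIdx_bot
      · rw [neg_neg]
        exact boundedOfIdx_top
      · change _ = Bounded.mid (dneg (outer p hp))
        rw [dneg_outer, ← ofK_of_ne]
        exact boundedOfIdx_mid (dneg p)
    · rfl
  map_one := rfl
  map_zero := rfl

/-! ### Iterating the construction -/

/-- Representations of `L` extend to the nested sums `S_n[L]` for odd `n`, preserving finiteness of
the underlying poset. -/
theorem exists_embedding (hL : IsDqRA L) {X : Type w} [PartialOrder X] {F : RelFrame X}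
    {φ : L → F.Dq} (hφ : IsQRAEmbedding φ) (k : ℕ) :
    ∃ (Y : Type w) (_ : PartialOrder Y) (G : RelFrame Y)
      (ψ : NestedSum (OddSugiharaChain (2 * k + 1)) L → G.Dq),
      IsQRAEmbedding ψ ∧ (Finite X → Finite Y) := by
  induction k with
  | zero => exact ⟨X, _, F, _, hφ.comp (isQRAEmbedding_toInner hL), id⟩
  | succ k ih =>
    obtain ⟨Y, _, G, ψ, hψ, hfin⟩ := ih
    -- Each pair of new extremes costs one padding of the poset, which adds four points for each
    -- block and for the extra block, hence finitely many over a finite poset.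
    refine ⟨G.Padded, _, _, _, (RelFrame.Padded.isQRAEmbedding_extend hψ).comp
      (isQRAEmbedding_toBounded hL (by omega)), fun h => ?_⟩
    have := hfin h
    infer_instance

end NestedSum

/-- If `L` is a (finitely) representable DqRA and `n ≥ 3` is odd, then the nested sum `S_n[L]` is a
(finitely) representable DqRA. -/
theorem corollary6p2 (n : ℕ) (hn : 3 ≤ n) (hodd : Odd n) (L : Type u) [QRAOps L] :
    (IsRepresentable.{u, w} L → IsRepresentable.{u, w} (NestedSum (OddSugiharaChain n) L)) ∧
    (IsFinitelyRepresentable.{u, w} L →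
      IsFinitelyRepresentable.{u, w} (NestedSum (OddSugiharaChain n) L)) := by
  obtain ⟨k, rfl⟩ := hodd
  constructor
  · rintro ⟨hL, X, _, F, φ, hφ⟩
    obtain ⟨Y, _, G, ψ, hψ, -⟩ := NestedSum.exists_embedding hL hφ k
    -- The embedding also supplies the DqRA laws of the nested sum.
    exact ⟨hψ.isDqRA (RelFrame.Dq.isDqRA G), Y, _, G, ψ, hψ⟩
  · rintro ⟨hL, X, _, hX, F, φ, hφ⟩
    obtain ⟨Y, _, G, ψ, hψ, hfin⟩ := NestedSum.exists_embedding hL hφ k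
    exact ⟨hψ.isDqRA (RelFrame.Dq.isDqRA G), Y, _, hfin hX, G, ψ, hψ⟩
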